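/- Consider a market with $m$ unit-demand buyers and $n$ unit-supply sellers of identical items. Let $b^{(1)}\ge\dots\ge b^{(m)}$ be the buyer values and $s^{(1)}\le\dots\le s^{(n)}$ the seller values in sorted order, put $s^{(n+1)}=\infty$, and let $r=\max\{i\le\min\{m,n\}: b^{(i)}\ge s^{(i)}\}$ (with $r=0$ if there is no such $i\ge 1$). The gains from trade (GFT) of an allocation is the sum of the values of the trading buyers minus the sum of the values of the trading sellers. The first-best allocation trades the $r$ highest-value buyers with the $r$ lowest-value sellers. Seller Trade Reduction (STR) is the following mechanism: if $b^{(r)}\ge s^{(r+1)}$, the $r$ highest-value buyers trade with the $r$ lowest-value sellers at price $s^{(r+1)}$; otherwise the $r-1$ highest-value buyers trade with the $r-1$ lowest-value sellers (nobody trades if $r\le 1$), each trading buyer pays $b^{(r)}$ and each trading seller receives $s^{(r)}$. For probability distributions $F_B,F_S$ on $\mathbb{R}$, let all values be independent, the buyers' drawn from $F_B$ and the sellers' from $F_S$, and let $\mathrm{Opt}(m,n)\in[0,\infty]$ and $\mathrm{Str}(m,n)\in[0,\infty]$ be the expected GFT of the first-best allocation and of STR (both GFTs are nonnegative at every profile).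 Say that $F_B$ first-order stochastically dominates $F_S$ if, for every $q\in(0,1)$, $\inf\{x: F_B(x)\ge q\}\ge\inf\{x: F_S(x)\ge q\}$. Theorem. There is an integer $c>0$ such that for all $m\ge n\ge 0$ and all probability distributions $F_B,F_S$ on $\mathbb{R}$ such that $F_B$ first-order stochastically dominates $F_S$, $$\mathrm{Str}(m+c,\,n+c)\;\ge\;\mathrm{Opt}(m,n).$$ -/

import Mathlib

open MeasureTheory

namespace DoubleAuction

noncomputable section

/-! ### Allocations and outcomes in a market with `m` unit-demand buyers and `n` unit-supply sellers -/

/-- An allocation, given by the set of buyers who trade (receive an item) and the set of sellers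
who trade (give their item away); the two sets have the same size. -/
structure Allocation (m n : ℕ) where
  buyers : Finset (Fin m)
  sellers : Finset (Fin n)
  card_eq : buyers.card = sellers.card

/-- Gains from trade of an allocation at the values `b` (buyers) and `s` (sellers). -/
def Allocation.gft {m n : ℕ} (A : Allocation m n) (b : Fin m → ℝ) (s : Fin n → ℝ) : ℝ :=
  ∑ i ∈ A.buyers, b i - ∑ j ∈ A.sellers, s j

/-- The outcome of a mechanism at one profile: an allocation, what each buyer pays, and what each
seller receives. -/
structure Outcome (m n : ℕ) where
  allocation : Allocation m n
  buyerPays : Fin m → ℝ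
  sellerGets : Fin n → ℝ

/-! ### Order statistics -/

/-- The buyers listed from the highest to the lowest value: `buyerRank b ⟨k, _⟩` is the buyer with
the `(k+1)`-th highest value (ties are broken by index). -/
def buyerRank {m : ℕ} (b : Fin m → ℝ) : Equiv.Perm (Fin m) :=
  Tuple.sort (fun i => -b i)

/-- The sellers listed from the lowest to the highest value: `sellerRank s ⟨k, _⟩` is the seller
with the `(k+1)`-th lowest value (ties are broken by index). -/
def sellerRank {n : ℕ} (s : Fin n → ℝ) : Equiv.Perm (Fin n) :=
  Tuple.sort s

/-- `b^{(k)}`, the `k`-th highest buyer value, for `1 ≤ k ≤ m` (and `0` for other `k`, a value that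
is never used). -/
def buyerStat {m : ℕ} (b : Fin m → ℝ) (k : ℕ) : ℝ :=
  if h : 1 ≤ k ∧ k ≤ m then b (buyerRank b ⟨k - 1, by omega⟩) else 0

/-- `s^{(k)}`, the `k`-th lowest seller value, for `1 ≤ k ≤ n` (and `0` for other `k`, a value that
is never used). -/
def sellerStat {n : ℕ} (s : Fin n → ℝ) (k : ℕ) : ℝ :=
  if h : 1 ≤ k ∧ k ≤ n then s (sellerRank s ⟨k - 1, by omega⟩) else 0

/-- The `k` highest-value buyers. -/
def topBuyers {m : ℕ} (b : Fin m → ℝ) (k : ℕ) : Finset (Fin m) :=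
  (Finset.univ.filter fun l : Fin m => (l : ℕ) < k).map (buyerRank b).toEmbedding

/-- The `k` lowest-value sellers. -/
def bottomSellers {n : ℕ} (s : Fin n → ℝ) (k : ℕ) : Finset (Fin n) :=
  (Finset.univ.filter fun l : Fin n => (l : ℕ) < k).map (sellerRank s).toEmbedding

/-- The allocation in which the `k` highest-value buyers trade with the `k` lowest-value sellers. -/
def topTrades {m n : ℕ} (b : Fin m → ℝ) (s : Fin n → ℝ) (k : ℕ) (hk : k ≤ min m n) :
    Allocation m n where
  buyers := topBuyers b k
  sellers := bottomSellers s k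
  card_eq := by
    simp only [topBuyers, bottomSellers, Finset.card_map, Fin.card_filter_val_lt]
    omega

/-! ### First best and Seller Trade Reduction -/

open Classical in
/-- The optimal trade size `r = max {k ≤ min m n : b^{(k)} ≥ s^{(k)}}`, with `r = 0` if there is
no such `k ≥ 1`. -/
def tradeSize {m n : ℕ} (b : Fin m → ℝ) (s : Fin n → ℝ) : ℕ :=
  Nat.findGreatest (fun k => sellerStat s k ≤ buyerStat b k) (min m n)

theorem tradeSize_le {m n : ℕ} (b : Fin m → ℝ) (s : Fin n → ℝ) : tradeSize b s ≤ min m n :=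
  Nat.findGreatest_le _

/-- The first-best allocation. -/
def firstBest {m n : ℕ} (b : Fin m → ℝ) (s : Fin n → ℝ) : Allocation m n :=
  topTrades b s (tradeSize b s) (tradeSize_le b s)

open Classical in
/-- The Seller Trade Reduction mechanism. With `r` the optimal trade size and `s^{(n+1)} = ∞`:
if `b^{(r)} ≥ s^{(r+1)}`, the `r` highest buyers trade with the `r` lowest sellers at the price
`s^{(r+1)}`; otherwise the `r - 1` highest buyers trade with the `r - 1` lowest sellers (nobody if
`r ≤ 1`), every trading buyer pays `b^{(r)}` and every trading seller receives `s^{(r)}`.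
Agents who do not trade pay and receive nothing. -/
def sellerTradeReduction {m n : ℕ} (b : Fin m → ℝ) (s : Fin n → ℝ) : Outcome m n :=
  let r := tradeSize b s
  if r + 1 ≤ n ∧ sellerStat s (r + 1) ≤ buyerStat b r then
    { allocation := topTrades b s r (tradeSize_le b s)
      buyerPays := fun i => if i ∈ topBuyers b r then sellerStat s (r + 1) else 0
      sellerGets := fun j => if j ∈ bottomSellers s r then sellerStat s (r + 1) else 0 }
  else
    { allocation := topTrades b s (r - 1) ((Nat.sub_le _ _).trans (tradeSize_le b s))
      buyerPays := fun i => if i ∈ topBuyers b (r - 1) then buyerStat b r else 0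
      sellerGets := fun j => if j ∈ bottomSellers s (r - 1) then sellerStat s r else 0 }

/-! ### Both gains from trade are nonnegative, so their expectations are well defined in `[0, ∞]` -/

theorem topTrades_gft_nonneg {m n : ℕ} (b : Fin m → ℝ) (s : Fin n → ℝ) (k : ℕ)
    (hk : k ≤ tradeSize b s) :
    0 ≤ (topTrades b s k (hk.trans (tradeSize_le b s))).gft b s := by
  classical
  rcases Nat.eq_zero_or_pos k with rfl | hk0
  · simp [Allocation.gft, topTrades, topBuyers, bottomSellers]
  have hr0 : tradeSize b s ≠ 0 := by omega
  have hle := tradeSize_le b s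
  have hr : sellerStat s (tradeSize b s) ≤ buyerStat b (tradeSize b s) := by
    have := (Nat.findGreatest_eq_iff
      (P := fun k => sellerStat s k ≤ buyerStat b k) (k := min m n)).1
      (rfl : Nat.findGreatest _ _ = tradeSize b s)
    exact this.2.1 hr0
  have hb : ∀ i ∈ topBuyers b k, buyerStat b (tradeSize b s) ≤ b i := by
    intro i hi
    simp only [topBuyers, Finset.mem_map, Finset.mem_filter, Finset.mem_univ, true_and] at hi
    obtain ⟨l, hl, rfl⟩ := hi
    have hmono := Tuple.monotone_sort (fun i => -b i)
    have hlt : tradeSize b s - 1 < m := by omega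
    have h1 := hmono (show l ≤ ⟨tradeSize b s - 1, hlt⟩ from Fin.le_def.2 (by simp; omega))
    have h2 : buyerStat b (tradeSize b s) = b (buyerRank b ⟨tradeSize b s - 1, hlt⟩) := by
      unfold buyerStat
      rw [dif_pos (by omega)]
    rw [h2]
    simpa [buyerRank] using h1
  have hs : ∀ j ∈ bottomSellers s k, s j ≤ sellerStat s (tradeSize b s) := by
    intro j hj
    simp only [bottomSellers, Finset.mem_map, Finset.mem_filter, Finset.mem_univ, true_and] at hj
    obtain ⟨l, hl, rfl⟩ := hj
    have hmono := Tuple.monotone_sort s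
    have hlt : tradeSize b s - 1 < n := by omega
    have h1 := hmono (show l ≤ ⟨tradeSize b s - 1, hlt⟩ from Fin.le_def.2 (by simp; omega))
    have h2 : sellerStat s (tradeSize b s) = s (sellerRank s ⟨tradeSize b s - 1, hlt⟩) := by
      unfold sellerStat
      rw [dif_pos (by omega)]
    rw [h2]
    simpa [sellerRank] using h1
  have h1 := Finset.card_nsmul_le_sum _ _ _ hb
  have h2 := Finset.sum_le_card_nsmul _ _ _ hs
  have h3 : (topBuyers b k).card = (bottomSellers s k).card :=
    (topTrades b s k (hk.trans hle)).card_eq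
  have h4 : (bottomSellers s k).card • sellerStat s (tradeSize b s)
      ≤ (topBuyers b k).card • buyerStat b (tradeSize b s) := by
    rw [h3]
    exact nsmul_le_nsmul_right hr _
  have h5 := (h2.trans h4).trans h1
  exact sub_nonneg.2 h5

theorem firstBest_gft_nonneg {m n : ℕ} (b : Fin m → ℝ) (s : Fin n → ℝ) :
    0 ≤ (firstBest b s).gft b s :=
  topTrades_gft_nonneg b s _ le_rfl

theorem sellerTradeReduction_gft_nonneg {m n : ℕ} (b : Fin m → ℝ) (s : Fin n → ℝ) :
    0 ≤ (sellerTradeReduction b s).allocation.gft b s := by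
  unfold sellerTradeReduction
  dsimp only
  split_ifs
  · exact topTrades_gft_nonneg b s _ le_rfl
  · exact topTrades_gft_nonneg b s _ (Nat.sub_le _ _)

/-! ### Value distributions and expected gains from trade -/

/-- The value at quantile `q`: `inf {x | Pr[X ≤ x] ≥ q}` for `X` distributed as `μ`
(meaningful for `0 < q < 1`). -/
def quantile (μ : Measure ℝ) (q : ℝ) : ℝ :=
  sInf {x : ℝ | q ≤ μ.real (Set.Iic x)}

/-- `μ` first-order stochastically dominates `ν`. -/
def FSD (μ ν : Measure ℝ) : Prop :=
  ∀ q ∈ Set.Ioo (0 : ℝ) 1, quantile ν q ≤ quantile μ q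

/-- The law of a value profile: `m` buyer values with law `FB` and `n` seller values with law `FS`,
all independent. -/
def profileLaw (FB FS : Measure ℝ) (m n : ℕ) : Measure ((Fin m → ℝ) × (Fin n → ℝ)) :=
  (Measure.pi fun _ : Fin m => FB).prod (Measure.pi fun _ : Fin n => FS)

/-- Expected first-best gains from trade with `m` buyers and `n` sellers, in `[0, ∞]`. -/
def expectedOPT (FB FS : Measure ℝ) (m n : ℕ) : ENNReal :=
  ∫⁻ v, ENNReal.ofReal ((firstBest v.1 v.2).gft v.1 v.2) ∂(profileLaw FB FS m n)

/-- Expected gains from trade of Seller Trade Reduction with `m` buyers and `n` sellers,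
in `[0, ∞]`. -/
def expectedSTR (FB FS : Measure ℝ) (m n : ℕ) : ENNReal :=
  ∫⁻ v, ENNReal.ofReal ((sellerTradeReduction v.1 v.2).allocation.gft v.1 v.2)
    ∂(profileLaw FB FS m n)

end

end DoubleAuction

/-!
Let `M = m + 64`, `N = n + 64`.  By stochastic dominance the values can be written as `Q_B(u)` for
buyers and `Q_S(u)` for sellers, with increasing functions `Q_S ≤ Q_B` and independent uniform
quantiles `u` (`map_quantile`).  All `M + N` agents then draw from the same law, so one may fix the
quantiles and average over the bijections `π` from agents to quantiles; deleting the last `64`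
buyers and the last `64` sellers turns the large market into the small one.  It remains to show,
for fixed quantiles, that the average loss of Seller Trade Reduction in the large market is at most
the average loss of the first best under the deletion
(`sum_firstBest_le_sum_sellerTradeReduction`).

The deletion loss is bounded below by linear programming duality: at a clearing price `p` the first
best is `∑ (bᵢ - p)⁺ + ∑ (p - sⱼ)⁺`, and this expression bounds every allocation of a smaller
market (`firstBest_gft_deletion`).  Two bounds follow.

* If Seller Trade Reduction loses `g = b^{(r)} - s^{(r)} > 0`, then `b^{(r)}` is a clearing price,
  so the deletion loses `g` for every deleted seller valued at most `s^{(r)}`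
  (`firstBest_gft_add_loss_le`).  On average there are at least `64 r / N` such sellers, so
  half of the deletion loss covers `g` on the event `r > N / 32`, where this number is at least `2`.
* Always `g ≤ D`, the buyer value of the highest quantile minus the seller value of the lowest one.
  The deletion loses `D` when the highest quantile is a deleted buyer and the lowest a deleted
  seller (`firstBest_gft_add_pair_le`), which has probability `64² / (T (T - 1))` with `T = M + N`.
  The event `r ≤ N / 32` forces almost all of the top `N` quantiles to belong to sellers; as
  `N ≤ M`, its probability is exponentially small in `N`, and at most half of the former
  (`two_mul_card_few_trades_le`).  So the other half of the deletion loss covers `g` on this event.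
-/

namespace DoubleAuction

/-! ### Order statistics -/

theorem mem_bottomSellers {n : ℕ} {s : Fin n → ℝ} {k : ℕ} {j : Fin n} :
    j ∈ bottomSellers s k ↔ ((sellerRank s).symm j : ℕ) < k := by
  simp only [bottomSellers, Finset.mem_map, Finset.mem_filter, Finset.mem_univ, true_and]
  constructor
  · rintro ⟨l, hl, rfl⟩
    simpa using hl
  · intro h
    exact ⟨_, h, by simp⟩

theorem card_bottomSellers {n : ℕ} (s : Fin n → ℝ) {k : ℕ} (hk : k ≤ n) :
    (bottomSellers s k).card = k := by
  simp only [bottomSellers, Finset.card_map, Fin.card_filter_val_lt]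
  omega

theorem sellerStat_succ {n : ℕ} (s : Fin n → ℝ) (l : Fin n) :
    sellerStat s (l + 1) = s (sellerRank s l) := by
  unfold sellerStat
  rw [dif_pos ⟨by omega, by omega⟩]
  rfl

theorem sellerStat_mono {n : ℕ} (s : Fin n → ℝ) {k l : ℕ} (hk : 1 ≤ k) (hkl : k ≤ l)
    (hl : l ≤ n) : sellerStat s k ≤ sellerStat s l := by
  have h1 := sellerStat_succ s ⟨k - 1, by omega⟩
  have h2 := sellerStat_succ s ⟨l - 1, by omega⟩
  simp only [Nat.sub_add_cancel hk, Nat.sub_add_cancel (hk.trans hkl)] at h1 h2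
  rw [h1, h2]
  exact Tuple.monotone_sort s (Fin.le_def.2 (by simp only; omega))

theorem eq_sellerStat {n : ℕ} (s : Fin n → ℝ) (j : Fin n) :
    s j = sellerStat s (((sellerRank s).symm j : ℕ) + 1) := by
  rw [sellerStat_succ, Equiv.apply_symm_apply]

theorem le_sellerStat_of_mem {n : ℕ} {s : Fin n → ℝ} {k : ℕ} (hk : k ≤ n) {j : Fin n}
    (hj : j ∈ bottomSellers s k) : s j ≤ sellerStat s k := by
  rw [mem_bottomSellers] at hj
  rw [eq_sellerStat s j]
  exact sellerStat_mono s (by omega) (by omega) hk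

theorem sellerStat_le_of_notMem {n : ℕ} {s : Fin n → ℝ} {k : ℕ} {j : Fin n}
    (hj : j ∉ bottomSellers s k) : sellerStat s (k + 1) ≤ s j := by
  rw [mem_bottomSellers] at hj
  rw [eq_sellerStat s j]
  exact sellerStat_mono s (by omega) (by omega) (by omega)

theorem sellerStat_le_of_card {n : ℕ} {s : Fin n → ℝ} {k : ℕ} {x : ℝ} (hk : 1 ≤ k)
    (h : k ≤ (Finset.univ.filter fun j => s j ≤ x).card) : sellerStat s k ≤ x := by
  by_contra! hx
  have hkn : k ≤ n := h.trans ((Finset.card_le_univ _).trans (by simp))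
  have hsub : (Finset.univ.filter fun j => s j ≤ x) ⊆ bottomSellers s (k - 1) := by
    intro j hj
    by_contra hn
    have h1 := sellerStat_le_of_notMem hn
    rw [Nat.sub_add_cancel hk] at h1
    exact absurd (hx.trans_le h1) (not_lt.2 (Finset.mem_filter.1 hj).2)
  have := Finset.card_le_card hsub
  rw [card_bottomSellers s (by omega)] at this
  omega

theorem le_card_le_sellerStat {n : ℕ} (s : Fin n → ℝ) {k : ℕ} (hk : k ≤ n) :
    k ≤ (Finset.univ.filter fun j => s j ≤ sellerStat s k).card := by
  calc k = (bottomSellers s k).card := (card_bottomSellers s hk).symm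
    _ ≤ _ := Finset.card_le_card fun j hj => by
      simpa using le_sellerStat_of_mem hk hj

theorem sum_bottomSellers {n : ℕ} (s : Fin n → ℝ) {k : ℕ} (hk : k ≤ n) :
    ∑ j ∈ bottomSellers s k, s j = ∑ l ∈ Finset.range k, sellerStat s (l + 1) := by
  rw [bottomSellers, Finset.sum_map]
  refine Finset.sum_bij (fun (l : Fin n) _ => (l : ℕ)) ?_ ?_ ?_ ?_
  · intro l hl; simpa using hl
  · intro a _ b _ h; exact Fin.ext h
  · intro l hl
    rw [Finset.mem_range] at hl
    exact ⟨⟨l, by omega⟩, by simpa using hl, rfl⟩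
  · intro l _; exact (sellerStat_succ s l).symm

theorem sellerStat_comp_perm {n : ℕ} (s : Fin n → ℝ) (τ : Equiv.Perm (Fin n)) (k : ℕ) :
    sellerStat (s ∘ τ) k = sellerStat s k := by
  unfold sellerStat
  split_ifs with h
  · exact congrFun (Tuple.comp_perm_comp_sort_eq_comp_sort (f := s) (σ := τ)) _
  · rfl

/-- Buyers ranked by decreasing value are sellers ranked by increasing negated value, so every
fact about buyer order statistics is read off from the one about sellers. -/
theorem buyerStat_eq_neg {m : ℕ} (b : Fin m → ℝ) (k : ℕ) :
    buyerStat b k = -sellerStat (fun i => -b i) k := by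
  unfold buyerStat sellerStat
  split_ifs
  · rw [neg_neg]; rfl
  · simp

theorem topBuyers_eq {m : ℕ} (b : Fin m → ℝ) (k : ℕ) :
    topBuyers b k = bottomSellers (fun i => -b i) k := rfl

theorem buyerStat_le_of_mem {m : ℕ} {b : Fin m → ℝ} {k : ℕ} (hk : k ≤ m) {i : Fin m}
    (hi : i ∈ topBuyers b k) : buyerStat b k ≤ b i := by
  have := le_sellerStat_of_mem hk (topBuyers_eq b k ▸ hi)
  rw [buyerStat_eq_neg]
  linarith

theorem le_buyerStat_of_notMem {m : ℕ} {b : Fin m → ℝ} {k : ℕ} {i : Fin m}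
    (hi : i ∉ topBuyers b k) : b i ≤ buyerStat b (k + 1) := by
  have := sellerStat_le_of_notMem (topBuyers_eq b k ▸ hi)
  rw [buyerStat_eq_neg]
  linarith

theorem buyerStat_anti {m : ℕ} (b : Fin m → ℝ) {k l : ℕ} (hk : 1 ≤ k) (hkl : k ≤ l)
    (hl : l ≤ m) : buyerStat b l ≤ buyerStat b k := by
  rw [buyerStat_eq_neg, buyerStat_eq_neg]
  exact neg_le_neg (sellerStat_mono _ hk hkl hl)

theorem le_buyerStat_of_card {m : ℕ} {b : Fin m → ℝ} {k : ℕ} {x : ℝ} (hk : 1 ≤ k)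
    (h : k ≤ (Finset.univ.filter fun i => x ≤ b i).card) : x ≤ buyerStat b k := by
  have := sellerStat_le_of_card (s := fun i => -b i) (x := -x) hk (by simpa using h)
  rw [buyerStat_eq_neg]
  linarith

theorem sum_topBuyers {m : ℕ} (b : Fin m → ℝ) {k : ℕ} (hk : k ≤ m) :
    ∑ i ∈ topBuyers b k, b i = ∑ l ∈ Finset.range k, buyerStat b (l + 1) := by
  have := sum_bottomSellers (fun i => -b i) hk
  simp only [buyerStat_eq_neg, topBuyers_eq]
  rw [Finset.sum_neg_distrib] at this ⊢
  linarith

theorem exists_eq_sellerStat {n : ℕ} (s : Fin n → ℝ) {k : ℕ} (h1 : 1 ≤ k) (hk : k ≤ n) :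
    ∃ j, sellerStat s k = s j :=
  ⟨_, by rw [sellerStat, dif_pos ⟨h1, hk⟩]⟩

theorem exists_eq_buyerStat {m : ℕ} (b : Fin m → ℝ) {k : ℕ} (h1 : 1 ≤ k) (hk : k ≤ m) :
    ∃ i, buyerStat b k = b i :=
  ⟨_, by rw [buyerStat, dif_pos ⟨h1, hk⟩]⟩

/-! ### Trade sizes and gains from trade -/

theorem sellerStat_tradeSize_le {m n : ℕ} {b : Fin m → ℝ} {s : Fin n → ℝ}
    (h : tradeSize b s ≠ 0) :
    sellerStat s (tradeSize b s) ≤ buyerStat b (tradeSize b s) := by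
  classical
  exact ((Nat.findGreatest_eq_iff (P := fun k => sellerStat s k ≤ buyerStat b k)
    (k := min m n)).1 (rfl : Nat.findGreatest _ _ = tradeSize b s)).2.1 h

theorem le_tradeSize {m n : ℕ} {b : Fin m → ℝ} {s : Fin n → ℝ} {k : ℕ} (hk : k ≤ min m n)
    (h : sellerStat s k ≤ buyerStat b k) : k ≤ tradeSize b s := by
  classical
  exact Nat.le_findGreatest (P := fun k => sellerStat s k ≤ buyerStat b k) hk h

theorem topTrades_gft {m n : ℕ} (b : Fin m → ℝ) (s : Fin n → ℝ) {k : ℕ} (hk : k ≤ min m n) :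
    (topTrades b s k hk).gft b s =
      ∑ l ∈ Finset.range k, (buyerStat b (l + 1) - sellerStat s (l + 1)) := by
  rw [Finset.sum_sub_distrib, ← sum_topBuyers b (by omega), ← sum_bottomSellers s (by omega)]
  rfl

theorem firstBest_gft {m n : ℕ} (b : Fin m → ℝ) (s : Fin n → ℝ) :
    (firstBest b s).gft b s =
      ∑ l ∈ Finset.range (tradeSize b s), (buyerStat b (l + 1) - sellerStat s (l + 1)) :=
  topTrades_gft b s _

open Classical in
theorem sellerTradeReduction_gft {m n : ℕ} (b : Fin m → ℝ) (s : Fin n → ℝ) :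
    (sellerTradeReduction b s).allocation.gft b s =
      ∑ l ∈ Finset.range (if tradeSize b s + 1 ≤ n ∧
          sellerStat s (tradeSize b s + 1) ≤ buyerStat b (tradeSize b s)
        then tradeSize b s else tradeSize b s - 1),
        (buyerStat b (l + 1) - sellerStat s (l + 1)) := by
  unfold sellerTradeReduction
  dsimp only
  split_ifs
  · exact topTrades_gft b s (tradeSize_le b s)
  · exact topTrades_gft b s ((Nat.sub_le _ _).trans (tradeSize_le b s))

theorem tradeSize_comp_perm {m n : ℕ} (b : Fin m → ℝ) (s : Fin n → ℝ)
    (τ : Equiv.Perm (Fin n)) : tradeSize b (s ∘ τ) = tradeSize b s := by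
  simp only [tradeSize, sellerStat_comp_perm]

/-- The gains from trade that Seller Trade Reduction loses relative to the first best. -/
noncomputable def reductionLoss {m n : ℕ} (b : Fin m → ℝ) (s : Fin n → ℝ) : ℝ :=
  (firstBest b s).gft b s - (sellerTradeReduction b s).allocation.gft b s

theorem reductionLoss_comp_perm {m n : ℕ} (b : Fin m → ℝ) (s : Fin n → ℝ)
    (τ : Equiv.Perm (Fin n)) : reductionLoss b (s ∘ τ) = reductionLoss b s := by
  simp only [reductionLoss, firstBest_gft, sellerTradeReduction_gft, tradeSize_comp_perm,
    sellerStat_comp_perm]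

/-! ### Clearing prices -/

/-- A price `p` clears the market if the first-best gains from trade are the total surplus
`∑ᵢ (bᵢ - p)⁺ + ∑ⱼ (p - sⱼ)⁺` of agents who trade with the outside world at price `p`.  For any
`p` this total is an upper bound for the gains from trade of every allocation. -/
def IsClearingPrice {m n : ℕ} (b : Fin m → ℝ) (s : Fin n → ℝ) (p : ℝ) : Prop :=
  ∑ i, max (b i - p) 0 + ∑ j, max (p - s j) 0 = (firstBest b s).gft b s

theorem gft_le_price {m n : ℕ} (A : Allocation m n) (b : Fin m → ℝ) (s : Fin n → ℝ) (p : ℝ) :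
    A.gft b s ≤ ∑ i, max (b i - p) 0 + ∑ j, max (p - s j) 0 := by
  have h1 : ∑ i ∈ A.buyers, (b i - p) ≤ ∑ i, max (b i - p) 0 :=
    (Finset.sum_le_sum fun i _ => le_max_left _ _).trans
      (Finset.sum_le_univ_sum_of_nonneg fun i => le_max_right _ _)
  have h2 : ∑ j ∈ A.sellers, (p - s j) ≤ ∑ j, max (p - s j) 0 :=
    (Finset.sum_le_sum fun i _ => le_max_left _ _).trans
      (Finset.sum_le_univ_sum_of_nonneg fun i => le_max_right _ _)
  have h3 : (A.buyers.card : ℝ) = A.sellers.card := by rw [A.card_eq]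
  simp only [Finset.sum_sub_distrib, Finset.sum_const, nsmul_eq_mul] at h1 h2
  rw [h3] at h1
  unfold Allocation.gft
  linarith

theorem sum_max_eq_of_separates {α : Type*} [Fintype α] (S : Finset α) (f : α → ℝ)
    (h1 : ∀ i ∈ S, 0 ≤ f i) (h2 : ∀ i ∉ S, f i ≤ 0) :
    ∑ i, max (f i) 0 = ∑ i ∈ S, f i := by
  classical
  rw [← Finset.sum_subset (Finset.subset_univ S) fun i _ hi => max_eq_right (h2 i hi)]
  exact Finset.sum_congr rfl fun i hi => max_eq_left (h1 i hi)

/-- A price separating the trading from the non-trading agents on both sides clears the market. -/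
theorem isClearingPrice_of_separates {m n : ℕ} {b : Fin m → ℝ} {s : Fin n → ℝ} {p : ℝ}
    (hb : ∀ i ∈ topBuyers b (tradeSize b s), p ≤ b i)
    (hb' : ∀ i ∉ topBuyers b (tradeSize b s), b i ≤ p)
    (hs : ∀ j ∈ bottomSellers s (tradeSize b s), s j ≤ p)
    (hs' : ∀ j ∉ bottomSellers s (tradeSize b s), p ≤ s j) : IsClearingPrice b s p := by
  have hc := (firstBest b s).card_eq
  unfold IsClearingPrice
  rw [sum_max_eq_of_separates (topBuyers b (tradeSize b s)) _
      (fun i hi => sub_nonneg.2 (hb i hi)) (fun i hi => sub_nonpos.2 (hb' i hi)),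
    sum_max_eq_of_separates (bottomSellers s (tradeSize b s)) _
      (fun i hi => sub_nonneg.2 (hs i hi)) (fun i hi => sub_nonpos.2 (hs' i hi))]
  change (topBuyers b (tradeSize b s)).card = (bottomSellers s (tradeSize b s)).card at hc
  change _ = ∑ i ∈ topBuyers b (tradeSize b s), b i - ∑ j ∈ bottomSellers s (tradeSize b s), s j
  simp only [Finset.sum_sub_distrib, Finset.sum_const, hc]
  ring

theorem exists_between_finsets (A B : Finset ℝ) (h : ∀ x ∈ A, ∀ y ∈ B, x ≤ y) :
    ∃ p, (∀ x ∈ A, x ≤ p) ∧ ∀ y ∈ B, p ≤ y := by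
  rcases A.eq_empty_or_nonempty with rfl | hA
  · rcases B.eq_empty_or_nonempty with rfl | hB
    · exact ⟨0, by simp, by simp⟩
    · exact ⟨B.min' hB, by simp, fun y hy => Finset.min'_le _ _ hy⟩
  · exact ⟨A.max' hA, fun x hx => Finset.le_max' _ _ hx,
      fun y hy => Finset.max'_le _ _ _ fun x hx => h x hx y hy⟩

theorem exists_isClearingPrice {m n : ℕ} (b : Fin m → ℝ) (s : Fin n → ℝ) :
    ∃ p, IsClearingPrice b s p := by
  classical
  set r := tradeSize b s with hr
  have hrm : r ≤ min m n := tradeSize_le b s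
  obtain ⟨p, hp1, hp2⟩ := exists_between_finsets
    (((topBuyers b r)ᶜ.image b) ∪ ((bottomSellers s r).image s))
    (((topBuyers b r).image b) ∪ ((bottomSellers s r)ᶜ.image s)) (by
      simp only [Finset.mem_union, Finset.mem_image, Finset.mem_compl]
      rintro x (⟨i, hi, rfl⟩ | ⟨j, hj, rfl⟩) y (⟨i', hi', rfl⟩ | ⟨j', hj', rfl⟩)
      · have hlt := mem_bottomSellers.1 (topBuyers_eq b r ▸ hi')
        have hge := mem_bottomSellers.not.1 (topBuyers_eq b r ▸ hi)
        exact (le_buyerStat_of_notMem hi).trans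
          ((buyerStat_anti b (by omega) (Nat.le_succ r) (by omega)).trans
            (buyerStat_le_of_mem (by omega) hi'))
      · have hge := mem_bottomSellers.not.1 (topBuyers_eq b r ▸ hi)
        have hge' := mem_bottomSellers.not.1 hj'
        refine (le_buyerStat_of_notMem hi).trans (le_trans ?_ (sellerStat_le_of_notMem hj'))
        by_contra! hlt
        have := le_tradeSize (b := b) (s := s) (k := r + 1) (by omega) hlt.le
        omega
      · have hlt := mem_bottomSellers.1 hj
        exact (le_sellerStat_of_mem (by omega) hj).trans
          ((sellerStat_tradeSize_le (by omega)).trans (buyerStat_le_of_mem (by omega) hi'))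
      · have hlt := mem_bottomSellers.1 hj
        have hge := mem_bottomSellers.not.1 hj'
        exact (le_sellerStat_of_mem (by omega) hj).trans
          ((sellerStat_mono s (by omega) (Nat.le_succ r) (by omega)).trans
            (sellerStat_le_of_notMem hj')))
  simp only [Finset.mem_union, Finset.mem_image, Finset.mem_compl] at hp1 hp2
  exact ⟨p, isClearingPrice_of_separates (fun i hi => hp2 _ (.inl ⟨i, hi, rfl⟩))
    (fun i hi => hp1 _ (.inl ⟨i, hi, rfl⟩)) (fun i hi => hp1 _ (.inr ⟨i, hi, rfl⟩))
    (fun i hi => hp2 _ (.inr ⟨i, hi, rfl⟩))⟩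

/-- Deleting the last `c` buyers and the last `d` sellers costs at least the surplus that they
enjoy at a clearing price of the full market. -/
theorem firstBest_gft_deletion {m n c d : ℕ} {b : Fin (m + c) → ℝ} {s : Fin (n + d) → ℝ} {p : ℝ}
    (hp : IsClearingPrice b s p) :
    (firstBest (fun i => b (Fin.castAdd c i)) (fun j => s (Fin.castAdd d j))).gft
        (fun i => b (Fin.castAdd c i)) (fun j => s (Fin.castAdd d j)) +
      (∑ i, max (b (Fin.natAdd m i) - p) 0 + ∑ j, max (p - s (Fin.natAdd n j)) 0) ≤
      (firstBest b s).gft b s := by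
  rw [← hp, Fin.sum_univ_add, Fin.sum_univ_add]
  have := gft_le_price (firstBest (fun i => b (Fin.castAdd c i)) (fun j => s (Fin.castAdd d j)))
    (fun i => b (Fin.castAdd c i)) (fun j => s (Fin.castAdd d j)) p
  linarith

theorem firstBest_gft_castAdd_le {m n c d : ℕ} (b : Fin (m + c) → ℝ) (s : Fin (n + d) → ℝ) :
    (firstBest (fun i => b (Fin.castAdd c i)) (fun j => s (Fin.castAdd d j))).gft
        (fun i => b (Fin.castAdd c i)) (fun j => s (Fin.castAdd d j)) ≤
      (firstBest b s).gft b s := by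
  obtain ⟨p, hp⟩ := exists_isClearingPrice b s
  have h := firstBest_gft_deletion hp
  have h1 : 0 ≤ ∑ i, max (b (Fin.natAdd m i) - p) 0 :=
    Finset.sum_nonneg fun _ _ => le_max_right _ _
  have h2 : 0 ≤ ∑ j, max (p - s (Fin.natAdd n j)) 0 :=
    Finset.sum_nonneg fun _ _ => le_max_right _ _
  linarith

theorem firstBest_gft_add_pair_le {m n c d : ℕ} (b : Fin (m + c) → ℝ) (s : Fin (n + d) → ℝ)
    (i : Fin c) (j : Fin d) :
    (firstBest (fun i => b (Fin.castAdd c i)) (fun j => s (Fin.castAdd d j))).gft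
        (fun i => b (Fin.castAdd c i)) (fun j => s (Fin.castAdd d j)) +
      (b (Fin.natAdd m i) - s (Fin.natAdd n j)) ≤ (firstBest b s).gft b s := by
  obtain ⟨p, hp⟩ := exists_isClearingPrice b s
  have h := firstBest_gft_deletion hp
  have h1 : max (b (Fin.natAdd m i) - p) 0 ≤ ∑ i, max (b (Fin.natAdd m i) - p) 0 :=
    Finset.single_le_sum (f := fun i => max (b (Fin.natAdd m i) - p) 0)
      (fun _ _ => le_max_right _ _) (Finset.mem_univ i)
  have h2 : max (p - s (Fin.natAdd n j)) 0 ≤ ∑ j, max (p - s (Fin.natAdd n j)) 0 :=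
    Finset.single_le_sum (f := fun j => max (p - s (Fin.natAdd n j)) 0)
      (fun _ _ => le_max_right _ _) (Finset.mem_univ j)
  have h3 := le_max_left (b (Fin.natAdd m i) - p) 0
  have h4 := le_max_left (p - s (Fin.natAdd n j)) 0
  linarith

/-- Seller Trade Reduction loses something only if the lowest trading buyer value is itself a
clearing price; the loss is then the value of the last trade. -/
theorem reductionLoss_cases {m n : ℕ} (b : Fin m → ℝ) (s : Fin n → ℝ) :
    reductionLoss b s = 0 ∨ (1 ≤ tradeSize b s ∧ IsClearingPrice b s (buyerStat b (tradeSize b s)) ∧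
      reductionLoss b s = buyerStat b (tradeSize b s) - sellerStat s (tradeSize b s)) := by
  classical
  unfold reductionLoss
  rw [firstBest_gft, sellerTradeReduction_gft]
  have hrm : tradeSize b s ≤ min m n := tradeSize_le b s
  split_ifs with hw
  · left; ring
  · rcases Nat.eq_zero_or_pos (tradeSize b s) with h0 | h0
    · left; simp [h0]
    right
    refine ⟨h0, isClearingPrice_of_separates ?_ ?_ ?_ ?_, ?_⟩
    · exact fun i hi => buyerStat_le_of_mem (by omega) hi
    · intro i hi
      have := mem_bottomSellers.not.1 (topBuyers_eq b _ ▸ hi)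
      exact (le_buyerStat_of_notMem hi).trans (buyerStat_anti b h0 (Nat.le_succ _) (by omega))
    · exact fun j hj => (le_sellerStat_of_mem (by omega) hj).trans
        (sellerStat_tradeSize_le (by omega))
    · intro j hj
      have := mem_bottomSellers.not.1 hj
      refine le_trans ?_ (sellerStat_le_of_notMem hj)
      by_contra! hlt
      exact hw ⟨by omega, hlt.le⟩
    · obtain ⟨r, hr⟩ : ∃ r, tradeSize b s = r + 1 := ⟨_, (Nat.sub_add_cancel h0).symm⟩
      rw [hr, Finset.sum_range_succ]
      simp

theorem reductionLoss_nonneg {m n : ℕ} (b : Fin m → ℝ) (s : Fin n → ℝ) :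
    0 ≤ reductionLoss b s := by
  rcases reductionLoss_cases b s with h | ⟨h0, -, h⟩
  · exact h.ge
  · rw [h]
    exact sub_nonneg.2 (sellerStat_tradeSize_le (by omega))

theorem reductionLoss_le {m n : ℕ} {b : Fin m → ℝ} {s : Fin n → ℝ} {x y : ℝ} (hxy : y ≤ x)
    (hb : ∀ i, b i ≤ x) (hs : ∀ j, y ≤ s j) : reductionLoss b s ≤ x - y := by
  have hrm : tradeSize b s ≤ min m n := tradeSize_le b s
  rcases reductionLoss_cases b s with h | ⟨h0, -, h⟩
  · rw [h]; exact sub_nonneg.2 hxy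
  · obtain ⟨i, hi⟩ := exists_eq_buyerStat b h0 (by omega)
    obtain ⟨j, hj⟩ := exists_eq_sellerStat s h0 (by omega)
    rw [h, hi, hj]
    linarith [hb i, hs j]

/-- Each deleted seller whose value is at most that of the last trading seller costs the first
best at least the whole loss of Seller Trade Reduction. -/
theorem firstBest_gft_add_loss_le {m n c d : ℕ} (b : Fin (m + c) → ℝ) (s : Fin (n + d) → ℝ) :
    (firstBest (fun i => b (Fin.castAdd c i)) (fun j => s (Fin.castAdd d j))).gft
        (fun i => b (Fin.castAdd c i)) (fun j => s (Fin.castAdd d j)) +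
      ∑ j : Fin d, (if s (Fin.natAdd n j) ≤ sellerStat s (tradeSize b s)
        then reductionLoss b s else 0) ≤ (firstBest b s).gft b s := by
  rcases reductionLoss_cases b s with h | ⟨h0, hp, h⟩
  · simpa [h] using firstBest_gft_castAdd_le b s
  · have h1 := firstBest_gft_deletion hp
    have h2 : 0 ≤ ∑ i, max (b (Fin.natAdd m i) - buyerStat b (tradeSize b s)) 0 :=
      Finset.sum_nonneg fun _ _ => le_max_right _ _
    have h3 : ∑ j : Fin d, (if s (Fin.natAdd n j) ≤ sellerStat s (tradeSize b s)
        then reductionLoss b s else 0) ≤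
        ∑ j, max (buyerStat b (tradeSize b s) - s (Fin.natAdd n j)) 0 := by
      refine Finset.sum_le_sum fun j _ => ?_
      split_ifs with hj
      · exact le_max_of_le_left (by linarith)
      · exact le_max_right _ _
    linarith

/-! ### Counting assignments of agents to positions -/

/-- The number of bijections `ι ≃ α` extending a given injection of `h` elements does not depend
on the injection, so it is `|α|! / (|α|)_h`. -/
theorem card_equiv_extending {ι α : Type*} [Fintype ι] [Fintype α] [DecidableEq ι] [DecidableEq α]
    (e : ι ≃ α) {h : ℕ} (x : Fin h ↪ ι) (y : Fin h ↪ α) :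
    (Finset.univ.filter fun π : ι ≃ α => ∀ i, π (x i) = y i).card *
      (Fintype.card α).descFactorial h = (Fintype.card α).factorial := by
  have hconst : ∀ z : Fin h ↪ α, (Finset.univ.filter fun π : ι ≃ α => ∀ i, π (x i) = z i).card =
      (Finset.univ.filter fun π : ι ≃ α => ∀ i, π (x i) = y i).card := by
    intro z
    have := Equiv.Perm.isMultiplyPretransitive α h
    obtain ⟨g, hg⟩ := MulAction.exists_smul_eq (Equiv.Perm α) z y
    have hg' : ∀ i, g (z i) = y i := fun i => DFunLike.congr_fun hg i
    refine Finset.card_equiv (Equiv.equivCongr (Equiv.refl ι) g) fun π => ?_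
    simp only [Finset.mem_filter, Finset.mem_univ, true_and]
    refine forall_congr' fun i => ?_
    simp [← hg']
  have hsum := Finset.card_eq_sum_card_fiberwise (s := (Finset.univ : Finset (ι ≃ α)))
    (t := (Finset.univ : Finset (Fin h ↪ α))) (f := fun π => x.trans π.toEmbedding)
    (fun _ _ => Finset.mem_univ _)
  have hfib : ∀ z : Fin h ↪ α,
      (Finset.univ.filter fun π : ι ≃ α => x.trans π.toEmbedding = z) =
      Finset.univ.filter fun π : ι ≃ α => ∀ i, π (x i) = z i := by
    intro z
    ext π
    simp [DFunLike.ext_iff]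
  simp only [hfib, hconst, Finset.sum_const, Finset.card_univ, Fintype.card_equiv e,
    Fintype.card_embedding_eq, Fintype.card_fin, smul_eq_mul] at hsum
  rw [mul_comm, ← hsum, Fintype.card_congr e]

/-- The number of bijections mapping `h` given elements into a given set `S`. -/
theorem card_equiv_mapsTo {ι α : Type*} [Fintype ι] [Fintype α] [DecidableEq ι] [DecidableEq α]
    (e : ι ≃ α) {h : ℕ} (x : Fin h ↪ ι) (S : Finset α) :
    (Finset.univ.filter fun π : ι ≃ α => ∀ i, π (x i) ∈ S).card *
      (Fintype.card α).descFactorial h = S.card.descFactorial h * (Fintype.card α).factorial := by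
  -- classify the bijections by the injection into `S` that they induce
  let restr : (Fin h ↪ S) → (Fin h ↪ α) := fun y => y.trans (Function.Embedding.subtype _)
  have hU : (Finset.univ.filter fun π : ι ≃ α => ∀ i, π (x i) ∈ S) =
      Finset.univ.biUnion fun y : Fin h ↪ S =>
        Finset.univ.filter fun π : ι ≃ α => ∀ i, π (x i) = restr y i := by
    ext π
    simp only [Finset.mem_filter, Finset.mem_univ, true_and, Finset.mem_biUnion]
    constructor
    · intro hπ
      exact ⟨⟨fun i => ⟨π (x i), hπ i⟩, fun i j hij => by simpa using hij⟩, fun i => rfl⟩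
    · rintro ⟨y, hy⟩ i
      rw [hy i]
      exact (y i).2
  rw [hU, Finset.card_biUnion]
  · rw [Finset.sum_mul, Finset.sum_congr rfl fun y _ => card_equiv_extending e x (restr y)]
    simp [Fintype.card_embedding_eq]
  · intro y _ z _ hyz
    rw [Function.onFun, Finset.disjoint_left]
    intro π hπ hπ'
    simp only [Finset.mem_filter, Finset.mem_univ, true_and] at hπ hπ'
    refine hyz (DFunLike.ext _ _ fun i => Subtype.ext ?_)
    exact (hπ i).symm.trans (hπ' i)

/-- Union bound for the number of bijections that map at least `h` elements of `A` into `S`. -/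
theorem card_equiv_many_mapsTo_le {ι α : Type*} [Fintype ι] [Fintype α] [DecidableEq ι]
    [DecidableEq α] (e : ι ≃ α) {h : ℕ} (A : Finset ι) (S : Finset α) :
    (Finset.univ.filter fun π : ι ≃ α => h ≤ (A.filter fun a => π a ∈ S).card).card *
      (Fintype.card α).descFactorial h ≤
      A.card.choose h * (S.card.descFactorial h * (Fintype.card α).factorial) := by
  have hsub : (Finset.univ.filter fun π : ι ≃ α => h ≤ (A.filter fun a => π a ∈ S).card) ⊆
      (A.powersetCard h).biUnion fun H => Finset.univ.filter fun π : ι ≃ α => ∀ a ∈ H, π a ∈ S := by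
    intro π hπ
    obtain ⟨H, hH, hc⟩ := Finset.exists_subset_card_eq (Finset.mem_filter.1 hπ).2
    simp only [Finset.mem_biUnion, Finset.mem_powersetCard, Finset.mem_filter, Finset.mem_univ,
      true_and]
    exact ⟨H, ⟨hH.trans (Finset.filter_subset _ _), hc⟩,
      fun a ha => (Finset.mem_filter.1 (hH ha)).2⟩
  refine (Nat.mul_le_mul_right _ ((Finset.card_le_card hsub).trans Finset.card_biUnion_le)).trans ?_
  rw [Finset.sum_mul, ← Finset.card_powersetCard, ← smul_eq_mul, ← Finset.sum_const]
  refine Finset.sum_le_sum fun H hH => ?_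
  have hc := (Finset.mem_powersetCard.1 hH).2
  let x : Fin h ↪ ι := (H.equivFinOfCardEq hc).symm.toEmbedding.trans (Function.Embedding.subtype _)
  rw [← card_equiv_mapsTo e x S]
  refine Nat.mul_le_mul_right _ (Finset.card_le_card fun π hπ => ?_)
  simp only [Finset.mem_filter, Finset.mem_univ, true_and] at hπ ⊢
  exact fun i => hπ _ ((H.equivFinOfCardEq hc).symm i).2

/-! ### Numerical estimates -/

theorem choose_mul_pow_le_pow (N j : ℕ) (hj : j ≤ N) : N.choose j * 7 ^ (N - j) ≤ 8 ^ N := by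
  have h : (1 + 7 : ℕ) ^ N = _ := add_pow 1 7 N
  rw [show (1 + 7 : ℕ) = 8 from rfl] at h
  rw [h]
  have := Finset.single_le_sum (f := fun i => 1 ^ i * 7 ^ (N - i) * N.choose i)
    (fun _ _ => Nat.zero_le _) (Finset.mem_range.2 (Nat.lt_succ_of_le hj))
  simpa [mul_comm] using this

/-- The exponential decay of the probability that fewer than a fraction `1 / 32` of the sellers
can trade beats the polynomial factor `N ^ 2`. -/
theorem two_mul_choose_mul_sq_le (N : ℕ) (hN : 64 ≤ N) :
    2 * N.choose (N / 32) * N ^ 2 ≤ 64 ^ 2 * 2 ^ (N - N / 32 - 2) := by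
  obtain ⟨j, hj⟩ : ∃ j, j = N / 32 := ⟨_, rfl⟩
  rw [← hj]
  obtain ⟨t, ht, htlt⟩ : ∃ t, N = 32 * j + t ∧ t < 32 := ⟨N % 32, by omega, by omega⟩
  have h1 := choose_mul_pow_le_pow N j (by omega)
  have h2 : N ^ 2 * 14 ^ j * 4 ^ N ≤ 2 ^ 9 * 7 ^ N := by
    have hs : N ^ 2 ≤ 2 ^ 10 * 4 ^ j := by
      have : N ≤ 32 * 2 ^ j := by
        have : j + 1 ≤ 2 ^ j := Nat.lt_two_pow_self
        omega
      calc N ^ 2 ≤ (32 * 2 ^ j) ^ 2 := Nat.pow_le_pow_left this 2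
        _ = 2 ^ 10 * 4 ^ j := by rw [mul_pow, ← pow_mul, mul_comm j, pow_mul]; norm_num
    calc N ^ 2 * 14 ^ j * 4 ^ N
        ≤ (2 ^ 10 * 4 ^ j) * 16 ^ j * 4 ^ N := by gcongr; norm_num
      _ = 2 ^ 10 * (64 * 4 ^ 32) ^ j * 4 ^ t := by
          rw [ht, pow_add, pow_mul, mul_pow, show (64 : ℕ) = 4 * 16 by norm_num, mul_pow]; ring
      _ ≤ 2 ^ 9 * (128 * 4 ^ 32) ^ j * 4 ^ t := by
          have : 2 ≤ 2 ^ j := Nat.le_self_pow (by omega) 2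
          rw [show (128 : ℕ) * 4 ^ 32 = 2 * (64 * 4 ^ 32) by norm_num, mul_pow 2]
          calc 2 ^ 10 * (64 * 4 ^ 32) ^ j * 4 ^ t
              = 2 ^ 9 * (2 * (64 * 4 ^ 32) ^ j) * 4 ^ t := by ring
            _ ≤ _ := by gcongr
      _ ≤ 2 ^ 9 * (7 ^ 32) ^ j * 7 ^ t := by gcongr <;> norm_num
      _ = 2 ^ 9 * 7 ^ N := by rw [ht, pow_add, pow_mul, mul_assoc]
  have hpos : 0 < 4 * 14 ^ j * 7 ^ (N - j) := by positivity
  refine Nat.le_of_mul_le_mul_right ?_ hpos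
  have e1 : (8 : ℕ) ^ N = 2 ^ N * 4 ^ N := by rw [← mul_pow]; norm_num
  have e2 : (2 : ℕ) ^ N = 2 ^ (N - j - 2) * 4 * 2 ^ j := by
    rw [show (4 : ℕ) = 2 ^ 2 from rfl, ← pow_add, ← pow_add]; congr 1; omega
  have e3 : (7 : ℕ) ^ N = 7 ^ j * 7 ^ (N - j) := by rw [← pow_add]; congr 1; omega
  have e4 : (14 : ℕ) ^ j = 2 ^ j * 7 ^ j := by rw [← mul_pow]; norm_num
  calc 2 * N.choose j * N ^ 2 * (4 * 14 ^ j * 7 ^ (N - j))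
      = 8 * N ^ 2 * 14 ^ j * (N.choose j * 7 ^ (N - j)) := by ring
    _ ≤ 8 * N ^ 2 * 14 ^ j * 8 ^ N := by gcongr
    _ = 8 * 2 ^ N * (N ^ 2 * 14 ^ j * 4 ^ N) := by rw [e1]; ring
    _ ≤ 8 * 2 ^ N * (2 ^ 9 * 7 ^ N) := by gcongr
    _ = 64 ^ 2 * 2 ^ (N - j - 2) * (4 * 14 ^ j * 7 ^ (N - j)) := by rw [e2, e3, e4]; ring

/-- Only the ratio of the first two factors of the falling factorials depends on how unbalanced
the market is; each later factor `N - i` is at most half of `T - i`. -/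
theorem two_pow_mul_descFactorial_le {N T : ℕ} (h : 2 * N ≤ T) (l : ℕ) :
    2 ^ l * N.descFactorial (l + 2) * (T * (T - 1)) ≤ N ^ 2 * T.descFactorial (l + 2) := by
  induction l with
  | zero =>
    have h2 : N.descFactorial 2 ≤ N ^ 2 := Nat.descFactorial_le_pow N 2
    have h3 : T.descFactorial 2 = T * (T - 1) := by simp [Nat.descFactorial_succ, mul_comm]
    rw [zero_add, pow_zero, one_mul, h3]
    exact Nat.mul_le_mul_right _ h2
  | succ l ih =>
    rw [show l + 1 + 2 = (l + 2) + 1 by ring, Nat.descFactorial_succ N,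
      Nat.descFactorial_succ T (l + 2)]
    calc 2 ^ (l + 1) * ((N - (l + 2)) * N.descFactorial (l + 2)) * (T * (T - 1))
        = (2 * (N - (l + 2))) * (2 ^ l * N.descFactorial (l + 2) * (T * (T - 1))) := by ring
      _ ≤ (T - (l + 2)) * (N ^ 2 * T.descFactorial (l + 2)) :=
          Nat.mul_le_mul (by omega) ih
      _ = _ := by ring

/-! ### Averaging over all assignments of agents to quantiles -/

/-- If fewer than `k` trades are efficient, then at least `N + 1 - k` of the `N` highest quantiles
belong to sellers. -/
theorem card_sellers_of_tradeSize_lt {M N T : ℕ} (hNM : N ≤ M) (hT : T = M + N)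
    {β σ : Fin T → ℝ} (hβ : Antitone β) (hσ : Antitone σ) (hle : ∀ p, σ p ≤ β p)
    (π : Fin M ⊕ Fin N ≃ Fin T) {k : ℕ} (hk : k ≤ N)
    (h : tradeSize (fun i => β (π (Sum.inl i))) (fun j => σ (π (Sum.inr j))) < k) :
    N + 1 - k ≤ (Finset.univ.filter fun j : Fin N => (π (Sum.inr j) : ℕ) < N).card := by
  by_contra! hcard
  have hk1 : 1 ≤ k := by omega
  have hs : (Finset.univ.filter fun j : Fin N => (π (Sum.inr j) : ℕ) < N).card +
      (Finset.univ.filter fun j : Fin N => ¬ (π (Sum.inr j) : ℕ) < N).card = N := by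
    rw [Finset.card_filter_add_card_filter_not]; simp
  have htot : (Finset.univ.filter fun i : Fin M => (π (Sum.inl i) : ℕ) < N).card +
      (Finset.univ.filter fun j : Fin N => (π (Sum.inr j) : ℕ) < N).card = N := by
    have h1 : (Finset.univ.filter fun a : Fin M ⊕ Fin N => (π a : ℕ) < N).card =
        (Finset.univ.filter fun p : Fin T => (p : ℕ) < N).card :=
      Finset.card_equiv π (by simp)
    rw [Fin.card_filter_val_lt, Finset.card_filter, Fintype.sum_sum_type, ← Finset.card_filter,
      ← Finset.card_filter] at h1
    omega
  let q : Fin T := ⟨N - 1, by omega⟩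
  have hb : β q ≤ buyerStat (fun i => β (π (Sum.inl i))) k := by
    refine le_buyerStat_of_card hk1 (le_trans (by omega) (Finset.card_le_card
      (s := Finset.univ.filter fun i : Fin M => (π (Sum.inl i) : ℕ) < N) fun i hi => ?_))
    simp only [Finset.mem_filter, Finset.mem_univ, true_and] at hi ⊢
    exact hβ (Fin.le_def.2 (by simp only [q]; omega))
  have hs : sellerStat (fun j => σ (π (Sum.inr j))) k ≤ σ q := by
    refine sellerStat_le_of_card hk1 (le_trans (by omega) (Finset.card_le_card
      (s := Finset.univ.filter fun j : Fin N => ¬ (π (Sum.inr j) : ℕ) < N) fun i hi => ?_))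
    simp only [Finset.mem_filter, Finset.mem_univ, true_and] at hi ⊢
    exact hσ (Fin.le_def.2 (by simp only [q]; omega))
  have := le_tradeSize (k := k) (by omega) (hs.trans ((hle q).trans hb))
  omega

/-- The assignments for which fewer than `N / 32 + 1` trades are efficient are at most half as
many as those for which the highest quantile is one of `64` given buyers and the lowest quantile
is one of `64` given sellers. -/
theorem two_mul_card_few_trades_le {M N : ℕ} (hNM : N ≤ M) (hN : 64 ≤ N) {T : ℕ}
    (hT : T = M + N)
    {β σ : Fin T → ℝ} (hβ : Antitone β) (hσ : Antitone σ) (hle : ∀ p, σ p ≤ β p)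
    (x y : Fin T) (hxy : x ≠ y) (A : Finset (Fin M)) (B : Finset (Fin N)) (hA : A.card = 64)
    (hB : B.card = 64) :
    2 * (Finset.univ.filter fun π : Fin M ⊕ Fin N ≃ Fin T =>
        tradeSize (fun i => β (π (Sum.inl i))) (fun j => σ (π (Sum.inr j))) < N / 32 + 1).card ≤
      (Finset.univ.filter fun π : Fin M ⊕ Fin N ≃ Fin T =>
        (∃ i ∈ A, π (Sum.inl i) = x) ∧ ∃ j ∈ B, π (Sum.inr j) = y).card := by
  classical
  have e : Fin M ⊕ Fin N ≃ Fin T := finSumFinEquiv.trans (finCongr hT.symm)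
  obtain ⟨l, hl⟩ : ∃ l, N - N / 32 = l + 2 := ⟨N - N / 32 - 2, by omega⟩
  have hbad := card_equiv_many_mapsTo_le e (h := l + 2)
    ((Finset.univ : Finset (Fin N)).map Function.Embedding.inr)
    (Finset.univ.filter fun p : Fin T => (p : ℕ) < N)
  rw [Fin.card_filter_val_lt, Finset.card_map, Finset.card_univ, Fintype.card_fin,
    Fintype.card_fin, min_eq_right (by omega)] at hbad
  have hsub : (Finset.univ.filter fun π : Fin M ⊕ Fin N ≃ Fin T =>
        tradeSize (fun i => β (π (Sum.inl i))) (fun j => σ (π (Sum.inr j))) < N / 32 + 1) ⊆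
      Finset.univ.filter fun π : Fin M ⊕ Fin N ≃ Fin T =>
        l + 2 ≤ (((Finset.univ : Finset (Fin N)).map Function.Embedding.inr).filter fun a =>
          π a ∈ (Finset.univ.filter fun p : Fin T => (p : ℕ) < N)).card := by
    intro π hπ
    simp only [Finset.mem_filter, Finset.mem_univ, true_and] at hπ ⊢
    have := card_sellers_of_tradeSize_lt hNM hT hβ hσ hle π (by omega) hπ
    rw [Finset.filter_map, Finset.card_map]
    simp only [Function.comp_def, Function.Embedding.inr_apply]
    omega
  have hbad' := (Nat.mul_le_mul_right (T.descFactorial (l + 2)) (Finset.card_le_card hsub)).trans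
    hbad
  have hgood : (Finset.univ.filter fun π : Fin M ⊕ Fin N ≃ Fin T =>
        (∃ i ∈ A, π (Sum.inl i) = x) ∧ ∃ j ∈ B, π (Sum.inr j) = y).card * (T * (T - 1)) =
      64 ^ 2 * T.factorial := by
    have hU : (Finset.univ.filter fun π : Fin M ⊕ Fin N ≃ Fin T =>
        (∃ i ∈ A, π (Sum.inl i) = x) ∧ ∃ j ∈ B, π (Sum.inr j) = y) =
        (A ×ˢ B).biUnion fun a => Finset.univ.filter fun π : Fin M ⊕ Fin N ≃ Fin T =>
          π (Sum.inl a.1) = x ∧ π (Sum.inr a.2) = y := by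
      ext π
      simp only [Finset.mem_filter, Finset.mem_univ, true_and, Finset.mem_biUnion,
        Finset.mem_product]
      constructor
      · rintro ⟨⟨i, hi, hix⟩, j, hj, hjy⟩
        exact ⟨(i, j), ⟨hi, hj⟩, hix, hjy⟩
      · rintro ⟨a, ⟨hi, hj⟩, hix, hjy⟩
        exact ⟨⟨_, hi, hix⟩, _, hj, hjy⟩
    rw [hU, Finset.card_biUnion]
    · rw [Finset.sum_mul, Finset.sum_congr rfl (g := fun _ => T.factorial)]
      · simp [hA, hB]
      · intro a _
        let u : Fin 2 ↪ Fin M ⊕ Fin N := ⟨![Sum.inl a.1, Sum.inr a.2], by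
          intro i j; fin_cases i <;> fin_cases j <;> simp⟩
        let v : Fin 2 ↪ Fin T := ⟨![x, y], by
          intro i j; fin_cases i <;> fin_cases j <;> simp [hxy, hxy.symm]⟩
        have h2 := card_equiv_extending e u v
        have h3 : T.descFactorial 2 = T * (T - 1) := by simp [Nat.descFactorial_succ, mul_comm]
        rw [Fintype.card_fin, h3] at h2
        rw [← h2]
        congr 2
        ext π
        simp only [Finset.mem_filter, Finset.mem_univ, true_and, Fin.forall_fin_two]
        rfl
    · intro a _ a' _ haa
      rw [Function.onFun, Finset.disjoint_left]
      intro π hπ hπ'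
      simp only [Finset.mem_filter, Finset.mem_univ, true_and] at hπ hπ'
      have h1 := π.injective (hπ.1.trans hπ'.1.symm)
      have h2 := π.injective (hπ.2.trans hπ'.2.symm)
      exact haa (Prod.ext (Sum.inl_injective h1) (Sum.inr_injective h2))
  have hch : N.choose (l + 2) = N.choose (N / 32) := by
    rw [← Nat.choose_symm (by omega : N / 32 ≤ N), hl]
  have hnum := two_mul_choose_mul_sq_le N hN
  rw [hl, Nat.add_sub_cancel] at hnum
  rw [hch] at hbad'
  have hd := two_pow_mul_descFactorial_le (N := N) (T := T) (by omega) l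
  set a := (Finset.univ.filter fun π : Fin M ⊕ Fin N ≃ Fin T =>
        tradeSize (fun i => β (π (Sum.inl i))) (fun j => σ (π (Sum.inr j))) < N / 32 + 1).card
  set g := (Finset.univ.filter fun π : Fin M ⊕ Fin N ≃ Fin T =>
        (∃ i ∈ A, π (Sum.inl i) = x) ∧ ∃ j ∈ B, π (Sum.inr j) = y).card
  have hpos : 0 < T.descFactorial (l + 2) * (T * (T - 1)) * 2 ^ l := by
    have h1 : 0 < T.descFactorial (l + 2) := by
      rw [Nat.pos_iff_ne_zero, Ne, Nat.descFactorial_eq_zero_iff_lt]; omega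
    have h2 : 0 < T * (T - 1) := Nat.mul_pos (by omega) (by omega)
    positivity
  refine Nat.le_of_mul_le_mul_right ?_ hpos
  calc 2 * a * (T.descFactorial (l + 2) * (T * (T - 1)) * 2 ^ l)
      = 2 * (T * (T - 1)) * 2 ^ l * (a * T.descFactorial (l + 2)) := by ring
    _ ≤ 2 * (T * (T - 1)) * 2 ^ l *
        (N.choose (N / 32) * (N.descFactorial (l + 2) * T.factorial)) := by gcongr
    _ = 2 * N.choose (N / 32) * T.factorial *
        (2 ^ l * N.descFactorial (l + 2) * (T * (T - 1))) := by ring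
    _ ≤ 2 * N.choose (N / 32) * T.factorial * (N ^ 2 * T.descFactorial (l + 2)) := by gcongr
    _ = 2 * N.choose (N / 32) * N ^ 2 * (T.factorial * T.descFactorial (l + 2)) := by ring
    _ ≤ 64 ^ 2 * 2 ^ l * (T.factorial * T.descFactorial (l + 2)) := by gcongr
    _ = 64 ^ 2 * T.factorial * (2 ^ l * T.descFactorial (l + 2)) := by ring
    _ = g * (T * (T - 1)) * (2 ^ l * T.descFactorial (l + 2)) := by rw [hgood]
    _ = g * (T.descFactorial (l + 2) * (T * (T - 1)) * 2 ^ l) := by ring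

/-- By symmetry among the `N` sellers, a given seller is among those valued at most `s^{(r)}`
with conditional probability at least `r / N`. -/
theorem sum_tradeSize_mul_loss_le {M N : ℕ} {α : Type*} [Fintype α] [DecidableEq α]
    (β σ : α → ℝ) (D : Finset (Fin N)) :
    D.card * ∑ π : Fin M ⊕ Fin N ≃ α,
        tradeSize (fun i => β (π (Sum.inl i))) (fun j => σ (π (Sum.inr j))) *
          reductionLoss (fun i => β (π (Sum.inl i))) (fun j => σ (π (Sum.inr j))) ≤
      N * ∑ π : Fin M ⊕ Fin N ≃ α, ∑ j ∈ D,
        if σ (π (Sum.inr j)) ≤ sellerStat (fun j => σ (π (Sum.inr j)))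
            (tradeSize (fun i => β (π (Sum.inl i))) (fun j => σ (π (Sum.inr j))))
          then reductionLoss (fun i => β (π (Sum.inl i))) (fun j => σ (π (Sum.inr j))) else 0 := by
  classical
  set f : (Fin M ⊕ Fin N ≃ α) → Fin N → ℝ := fun π j =>
    if σ (π (Sum.inr j)) ≤ sellerStat (fun j => σ (π (Sum.inr j)))
            (tradeSize (fun i => β (π (Sum.inl i))) (fun j => σ (π (Sum.inr j))))
          then reductionLoss (fun i => β (π (Sum.inl i))) (fun j => σ (π (Sum.inr j))) else 0
    with hf
  have hsym : ∀ j j', ∑ π, f π j = ∑ π, f π j' := by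
    intro j j'
    let τ : Equiv.Perm (Fin N) := Equiv.swap j j'
    refine Fintype.sum_equiv (Equiv.equivCongr (Equiv.sumCongr (Equiv.refl _) τ) (Equiv.refl α))
      _ _ fun π => ?_
    have h1 := tradeSize_comp_perm (fun i => β (π (Sum.inl i))) (fun j => σ (π (Sum.inr j))) τ
    have h2 := sellerStat_comp_perm (fun j => σ (π (Sum.inr j))) τ
    have h3 := reductionLoss_comp_perm (fun i => β (π (Sum.inl i))) (fun j => σ (π (Sum.inr j))) τ
    have hτ : τ.symm = τ := Equiv.symm_swap j j'
    simp only [Function.comp_def] at h1 h2 h3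
    set π' := Equiv.equivCongr (Equiv.sumCongr (Equiv.refl (Fin M)) τ) (Equiv.refl α) π
    have hl : ∀ i, π' (Sum.inl i) = π (Sum.inl i) := fun i => rfl
    have hr : ∀ i, π' (Sum.inr i) = π (Sum.inr (τ i)) := fun i =>
      congrArg (fun t : Equiv.Perm (Fin N) => π (Sum.inr (t i))) hτ
    have hj : τ j' = j := Equiv.swap_apply_right j j'
    simp only [hf, hl, hr, h1, h2, h3, hj]
  have hpt : ∀ π : Fin M ⊕ Fin N ≃ α,
      tradeSize (fun i => β (π (Sum.inl i))) (fun j => σ (π (Sum.inr j))) *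
          reductionLoss (fun i => β (π (Sum.inl i))) (fun j => σ (π (Sum.inr j))) ≤
        ∑ j, f π j := by
    intro π
    have hr := tradeSize_le (fun i => β (π (Sum.inl i))) (fun j => σ (π (Sum.inr j)))
    simp only [hf]
    rw [← Finset.sum_filter, Finset.sum_const, nsmul_eq_mul]
    refine mul_le_mul_of_nonneg_right ?_ (reductionLoss_nonneg _ _)
    exact_mod_cast le_card_le_sellerStat (fun j => σ (π (Sum.inr j))) (by omega)
  calc _ ≤ (D.card : ℝ) * ∑ π, ∑ j, f π j :=
        mul_le_mul_of_nonneg_left (Finset.sum_le_sum fun π _ => hpt π) (Nat.cast_nonneg _)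
    _ = N * ∑ π, ∑ j ∈ D, f π j := by
      rw [Finset.sum_comm, Finset.sum_comm (s := Finset.univ) (t := D)]
      rcases isEmpty_or_nonempty (Fin N) with hE | ⟨⟨j₀⟩⟩
      · simp [Finset.eq_empty_of_isEmpty D]
      · rw [Finset.sum_congr rfl fun j _ => hsym j j₀,
          Finset.sum_congr (s₁ := D) rfl fun j _ => hsym j j₀]
        simp only [Finset.sum_const, Finset.card_univ, Fintype.card_fin, nsmul_eq_mul]
        ring

/-- The deterministic core of the theorem: averaged over all assignments of agents to fixed
quantiles, Seller Trade Reduction with `64` extra agents per side does at least as well as the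
first best without them. -/
theorem sum_firstBest_le_sum_sellerTradeReduction {m n T : ℕ} (hnm : n ≤ m)
    (hT : T = (m + 64) + (n + 64)) {β σ : Fin T → ℝ} (hβ : Antitone β) (hσ : Antitone σ)
    (hle : ∀ p, σ p ≤ β p) :
    ∑ π : Fin (m + 64) ⊕ Fin (n + 64) ≃ Fin T,
      (firstBest (fun i => β (π (Sum.inl (Fin.castAdd 64 i))))
          (fun j => σ (π (Sum.inr (Fin.castAdd 64 j))))).gft
        (fun i => β (π (Sum.inl (Fin.castAdd 64 i))))
        (fun j => σ (π (Sum.inr (Fin.castAdd 64 j)))) ≤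
    ∑ π : Fin (m + 64) ⊕ Fin (n + 64) ≃ Fin T,
      (sellerTradeReduction (fun i => β (π (Sum.inl i)))
          (fun j => σ (π (Sum.inr j)))).allocation.gft
        (fun i => β (π (Sum.inl i))) (fun j => σ (π (Sum.inr j))) := by
  classical
  set k := (n + 64) / 32 + 1 with hk
  let x : Fin T := ⟨0, by omega⟩
  let y : Fin T := ⟨T - 1, by omega⟩
  have hxy : x ≠ y := by simp [x, y, Fin.ext_iff]; omega
  set D := β x - σ y with hD
  have hyx : σ y ≤ β x := (hle y).trans (hβ (Fin.le_def.2 (Nat.zero_le _)))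
  have hD0 : 0 ≤ D := sub_nonneg.2 hyx
  set b : (Fin (m + 64) ⊕ Fin (n + 64) ≃ Fin T) → Fin (m + 64) → ℝ := fun π i => β (π (Sum.inl i))
    with hb
  set s : (Fin (m + 64) ⊕ Fin (n + 64) ≃ Fin T) → Fin (n + 64) → ℝ := fun π j => σ (π (Sum.inr j))
    with hs
  set V : (Fin (m + 64) ⊕ Fin (n + 64) ≃ Fin T) → ℝ := fun π =>
    (firstBest (b π) (s π)).gft (b π) (s π)
  set V' : (Fin (m + 64) ⊕ Fin (n + 64) ≃ Fin T) → ℝ := fun π =>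
    (firstBest (fun i => b π (Fin.castAdd 64 i)) (fun j => s π (Fin.castAdd 64 j))).gft
      (fun i => b π (Fin.castAdd 64 i)) (fun j => s π (Fin.castAdd 64 j))
  set g : (Fin (m + 64) ⊕ Fin (n + 64) ≃ Fin T) → ℝ := fun π => reductionLoss (b π) (s π) with hg
  have hg0 : ∀ π, 0 ≤ g π := fun π => reductionLoss_nonneg _ _
  have hgD : ∀ π, g π ≤ D := fun π => reductionLoss_le hyx
    (fun i => hβ (Fin.le_def.2 (Nat.zero_le _)))
    (fun j => hσ (Fin.le_def.2 (by simp only [y]; omega)))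
  let A : Finset (Fin (m + 64)) := Finset.univ.map (Fin.natAddEmb m)
  let B : Finset (Fin (n + 64)) := Finset.univ.map (Fin.natAddEmb n)
  -- assignments with few efficient trades, and with the extreme quantiles among the extra agents
  set bad := Finset.univ.filter fun π => tradeSize (b π) (s π) < k with hbad
  set ext := Finset.univ.filter fun π : Fin (m + 64) ⊕ Fin (n + 64) ≃ Fin T =>
    (∃ i ∈ A, π (Sum.inl i) = x) ∧ ∃ j ∈ B, π (Sum.inr j) = y with hext
  have hcard : 2 * bad.card ≤ ext.card :=
    two_mul_card_few_trades_le (by omega) (by omega) hT hβ hσ hle x y hxy A B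
      (by simp [A]) (by simp [B])
  have hL : ∑ π ∈ ext, D ≤ ∑ π, (V π - V' π) := by
    refine (Finset.sum_le_sum fun π hπ => ?_).trans (Finset.sum_le_univ_sum_of_nonneg
      fun π => sub_nonneg.2 (firstBest_gft_castAdd_le (b π) (s π)))
    simp only [hext, Finset.mem_filter, Finset.mem_univ, true_and, A, B, Finset.mem_map,
      Fin.natAddEmb_apply] at hπ
    obtain ⟨⟨_, ⟨i, rfl⟩, hi⟩, _, ⟨j, rfl⟩, hj⟩ := hπ
    have := firstBest_gft_add_pair_le (b π) (s π) i j
    simp only [hb, hs, hi, hj] at this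
    simp only [hD, V, V', hb, hs]
    linarith
  have hloss : ∑ π, ∑ j ∈ B, (if s π j ≤ sellerStat (s π) (tradeSize (b π) (s π)) then g π else 0) ≤
      ∑ π, (V π - V' π) := by
    refine Finset.sum_le_sum fun π _ => ?_
    have := firstBest_gft_add_loss_le (b π) (s π)
    rw [Finset.sum_map]
    simp only [Fin.natAddEmb_apply]
    linarith
  have havg := sum_tradeSize_mul_loss_le (M := m + 64) (N := n + 64) β σ B
  have hgood : (2 * (n + 64 : ℕ) : ℝ) * ∑ π ∈ badᶜ, g π ≤
      B.card * ∑ π, (tradeSize (b π) (s π) : ℝ) * g π := by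
    rw [Finset.mul_sum, Finset.mul_sum]
    refine (Finset.sum_le_sum fun π hπ => ?_).trans (Finset.sum_le_univ_sum_of_nonneg
      (f := fun π => (B.card : ℝ) * ((tradeSize (b π) (s π) : ℝ) * g π))
      fun π => mul_nonneg (Nat.cast_nonneg _) (mul_nonneg (Nat.cast_nonneg _) (hg0 π)))
    simp only [hbad, Finset.mem_compl, Finset.mem_filter, Finset.mem_univ, true_and, not_lt] at hπ
    rw [← mul_assoc]
    refine mul_le_mul_of_nonneg_right ?_ (hg0 π)
    have hB : B.card = 64 := by simp [B]
    rw [hB]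
    exact_mod_cast (by omega : 2 * (n + 64) ≤ 64 * tradeSize (b π) (s π))
  -- each of the two lower bounds for the deletion loss pays for one half of the total
  have hgood' : 2 * ∑ π ∈ badᶜ, g π ≤ ∑ π, (V π - V' π) := by
    have hN : (0 : ℝ) < ((n + 64 : ℕ) : ℝ) := by positivity
    refine le_of_mul_le_mul_left ?_ hN
    calc ((n + 64 : ℕ) : ℝ) * (2 * ∑ π ∈ badᶜ, g π)
        = (2 * (n + 64 : ℕ) : ℝ) * ∑ π ∈ badᶜ, g π := by ring
      _ ≤ _ := hgood.trans havg
      _ ≤ _ := mul_le_mul_of_nonneg_left hloss hN.le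
  have hbadsum : 2 * ∑ π ∈ bad, g π ≤ ∑ π ∈ ext, D := by
    calc 2 * ∑ π ∈ bad, g π ≤ 2 * ∑ π ∈ bad, D := by gcongr with π _; exact hgD π
      _ = ((2 * bad.card : ℕ) : ℝ) * D := by rw [Finset.sum_const, nsmul_eq_mul]; push_cast; ring
      _ ≤ (ext.card : ℝ) * D := by gcongr
      _ = _ := by rw [Finset.sum_const, nsmul_eq_mul]
  have hsplit := Finset.sum_add_sum_compl bad g
  have hfin : ∑ π, g π ≤ ∑ π, (V π - V' π) := by linarith
  have hgV : ∀ π, g π = V π - (sellerTradeReduction (b π) (s π)).allocation.gft (b π) (s π) :=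
    fun π => rfl
  simp only [hgV, Finset.sum_sub_distrib] at hfin
  change ∑ π, V' π ≤ ∑ π, (sellerTradeReduction (b π) (s π)).allocation.gft (b π) (s π)
  linarith

/-! ### Measurability of the gains from trade -/

theorem measurable_sellerStat {n : ℕ} (k : ℕ) : Measurable fun s : Fin n → ℝ => sellerStat s k := by
  by_cases hk : 1 ≤ k ∧ k ≤ n
  · refine measurable_of_Iic fun x => ?_
    have hset : (fun s : Fin n → ℝ => sellerStat s k) ⁻¹' Set.Iic x =
        {s | k ≤ ∑ j, if s j ≤ x then 1 else 0} := by
      ext s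
      simp only [Set.mem_preimage, Set.mem_Iic, Set.mem_ofPred_eq, ← Finset.card_filter]
      refine ⟨fun h => (le_card_le_sellerStat s hk.2).trans (Finset.card_le_card fun j hj => ?_),
        fun h => sellerStat_le_of_card hk.1 h⟩
      simp only [Finset.mem_filter, Finset.mem_univ, true_and] at hj ⊢
      exact hj.trans h
    rw [hset]
    refine measurableSet_le measurable_const (Finset.measurable_sum _ fun j _ => ?_)
    exact Measurable.ite (measurableSet_le (measurable_pi_apply j) measurable_const)
      measurable_const measurable_const
  · simp only [sellerStat, dif_neg hk]
    exact measurable_const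

theorem measurable_buyerStat {m : ℕ} (k : ℕ) : Measurable fun b : Fin m → ℝ => buyerStat b k := by
  simp only [buyerStat_eq_neg]
  exact ((measurable_sellerStat k).comp
    (measurable_pi_lambda _ fun i => (measurable_pi_apply i).neg)).neg

theorem measurable_tradeSize {m n : ℕ} :
    Measurable fun v : (Fin m → ℝ) × (Fin n → ℝ) => tradeSize v.1 v.2 := by
  classical
  exact measurable_findGreatest fun k _ => measurableSet_le
    ((measurable_sellerStat k).comp measurable_snd) ((measurable_buyerStat k).comp measurable_fst)

theorem measurable_sum_trades {m n : ℕ} {K : (Fin m → ℝ) × (Fin n → ℝ) → ℕ} (hK : Measurable K) :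
    Measurable fun v : (Fin m → ℝ) × (Fin n → ℝ) =>
      ∑ l ∈ Finset.range (K v), (buyerStat v.1 (l + 1) - sellerStat v.2 (l + 1)) := by
  have h : Measurable fun w : ℕ × ((Fin m → ℝ) × (Fin n → ℝ)) =>
      ∑ l ∈ Finset.range w.1, (buyerStat w.2.1 (l + 1) - sellerStat w.2.2 (l + 1)) :=
    measurable_from_prod_countable_right fun k =>
      Finset.measurable_sum (Finset.range k) fun l _ =>
        ((measurable_buyerStat (l + 1)).comp measurable_fst).sub
          ((measurable_sellerStat (l + 1)).comp measurable_snd)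
  exact h.comp (hK.prodMk measurable_id)

theorem measurable_firstBest_gft {m n : ℕ} :
    Measurable fun v : (Fin m → ℝ) × (Fin n → ℝ) => (firstBest v.1 v.2).gft v.1 v.2 := by
  simp only [firstBest_gft]
  exact measurable_sum_trades measurable_tradeSize

theorem measurable_sellerTradeReduction_gft {m n : ℕ} :
    Measurable fun v : (Fin m → ℝ) × (Fin n → ℝ) =>
      (sellerTradeReduction v.1 v.2).allocation.gft v.1 v.2 := by
  classical
  simp only [sellerTradeReduction_gft]
  refine measurable_sum_trades (Measurable.ite ?_ measurable_tradeSize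
    ((measurable_of_countable fun r : ℕ => r - 1).comp measurable_tradeSize))
  have hs : Measurable fun w : ℕ × ((Fin m → ℝ) × (Fin n → ℝ)) => sellerStat w.2.2 (w.1 + 1) :=
    measurable_from_prod_countable_right fun k =>
      (measurable_sellerStat (k + 1)).comp measurable_snd
  have hb : Measurable fun w : ℕ × ((Fin m → ℝ) × (Fin n → ℝ)) => buyerStat w.2.1 w.1 :=
    measurable_from_prod_countable_right fun k =>
      (measurable_buyerStat k).comp measurable_fst
  have hid := (measurable_tradeSize (m := m) (n := n)).prodMk measurable_id
  exact (measurableSet_le (measurable_tradeSize.add_const 1) measurable_const).inter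
    (measurableSet_le (hs.comp hid) (hb.comp hid))

/-! ### Independent quantiles -/

theorem measurePreserving_comp_injective {Ω ι κ : Type*} [MeasurableSpace Ω] [Fintype ι]
    [Fintype κ] (ρ : Measure Ω) [IsProbabilityMeasure ρ] {f : κ → ι} (hf : f.Injective) :
    MeasurePreserving (fun (u : ι → Ω) k => u (f k)) (Measure.pi fun _ => ρ)
      (Measure.pi fun _ => ρ) := by
  have hind : ProbabilityTheory.iIndepFun (fun i (u : ι → Ω) => u i) (Measure.pi fun _ => ρ) :=
    ProbabilityTheory.iIndepFun_pi (X := fun _ x => x) fun _ => aemeasurable_id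
  refine ⟨measurable_pi_lambda _ fun k => measurable_pi_apply _, ?_⟩
  rw [(ProbabilityTheory.iIndepFun_iff_map_fun_eq_pi_map
    fun k => (measurable_pi_apply (f k)).aemeasurable).1 (hind.precomp hf)]
  congr 1
  ext1 k
  exact (measurePreserving_eval (fun _ : ι => ρ) (f k)).map_eq

/-- The value profile of `m` buyers and `n` sellers whose values are given by the functions `QB`
and `QS` at independent draws, the agents sitting at prescribed coordinates. -/
theorem measurePreserving_profile {Ω ι : Type*} [MeasurableSpace Ω] [Fintype ι]
    (ρ : Measure Ω) [IsProbabilityMeasure ρ] {QB QS : Ω → ℝ} (hB : Measurable QB)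
    (hS : Measurable QS) {m n : ℕ} {f : Fin m ⊕ Fin n → ι} (hf : f.Injective) :
    MeasurePreserving (fun u : ι → Ω =>
        ((fun i => QB (u (f (Sum.inl i)))), fun j => QS (u (f (Sum.inr j)))))
      (Measure.pi fun _ => ρ) (profileLaw (ρ.map QB) (ρ.map QS) m n) := by
  have : IsProbabilityMeasure (ρ.map QB) := Measure.isProbabilityMeasure_map hB.aemeasurable
  have : IsProbabilityMeasure (ρ.map QS) := Measure.isProbabilityMeasure_map hS.aemeasurable
  have h1 := (measurePreserving_sumPiEquivProdPi (X := fun _ : Fin m ⊕ Fin n => Ω)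
    fun _ => ρ).comp (measurePreserving_comp_injective ρ hf)
  have h2 : MeasurePreserving (fun (x : Fin m → Ω) i => QB (x i)) (Measure.pi fun _ => ρ)
      (Measure.pi fun _ => ρ.map QB) :=
    measurePreserving_pi _ _ fun _ => ⟨hB, rfl⟩
  have h3 : MeasurePreserving (fun (x : Fin n → Ω) i => QS (x i)) (Measure.pi fun _ => ρ)
      (Measure.pi fun _ => ρ.map QS) :=
    measurePreserving_pi _ _ fun _ => ⟨hS, rfl⟩
  exact (h2.prod h3).comp h1

/-- `expectedOPT` computed from a larger family of independent draws. -/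
theorem lintegral_firstBest_gft {Ω ι : Type*} [MeasurableSpace Ω] [Fintype ι]
    (ρ : Measure Ω) [IsProbabilityMeasure ρ] {QB QS : Ω → ℝ} (hB : Measurable QB)
    (hS : Measurable QS) {m n : ℕ} {f : Fin m ⊕ Fin n → ι} (hf : f.Injective) :
    AEMeasurable (fun u : ι → Ω => ENNReal.ofReal
      ((firstBest (fun i => QB (u (f (Sum.inl i)))) (fun j => QS (u (f (Sum.inr j))))).gft
        (fun i => QB (u (f (Sum.inl i)))) (fun j => QS (u (f (Sum.inr j))))))
      (Measure.pi fun _ => ρ) ∧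
    ∫⁻ u : ι → Ω, ENNReal.ofReal
      ((firstBest (fun i => QB (u (f (Sum.inl i)))) (fun j => QS (u (f (Sum.inr j))))).gft
        (fun i => QB (u (f (Sum.inl i)))) (fun j => QS (u (f (Sum.inr j)))))
      ∂(Measure.pi fun _ => ρ) = expectedOPT (ρ.map QB) (ρ.map QS) m n :=
  have h := measurePreserving_profile ρ hB hS hf
  have hm := (measurable_firstBest_gft (m := m) (n := n)).ennreal_ofReal
  ⟨(hm.comp h.measurable).aemeasurable, h.lintegral_comp hm⟩

theorem lintegral_sellerTradeReduction_gft {Ω ι : Type*} [MeasurableSpace Ω] [Fintype ι]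
    (ρ : Measure Ω) [IsProbabilityMeasure ρ] {QB QS : Ω → ℝ} (hB : Measurable QB)
    (hS : Measurable QS) {m n : ℕ} {f : Fin m ⊕ Fin n → ι} (hf : f.Injective) :
    AEMeasurable (fun u : ι → Ω => ENNReal.ofReal
      ((sellerTradeReduction (fun i => QB (u (f (Sum.inl i))))
          (fun j => QS (u (f (Sum.inr j))))).allocation.gft
        (fun i => QB (u (f (Sum.inl i)))) (fun j => QS (u (f (Sum.inr j))))))
      (Measure.pi fun _ => ρ) ∧
    ∫⁻ u : ι → Ω, ENNReal.ofReal
      ((sellerTradeReduction (fun i => QB (u (f (Sum.inl i))))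
          (fun j => QS (u (f (Sum.inr j))))).allocation.gft
        (fun i => QB (u (f (Sum.inl i)))) (fun j => QS (u (f (Sum.inr j)))))
      ∂(Measure.pi fun _ => ρ) = expectedSTR (ρ.map QB) (ρ.map QS) m n :=
  have h := measurePreserving_profile ρ hB hS hf
  have hm := (measurable_sellerTradeReduction_gft (m := m) (n := n)).ennreal_ofReal
  ⟨(hm.comp h.measurable).aemeasurable, h.lintegral_comp hm⟩

/-- The inequality for values that are increasing functions of independent quantiles. -/
theorem expectedOPT_le_expectedSTR_of_monotone {Ω : Type*} [MeasurableSpace Ω] [LinearOrder Ω]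
    (ρ : Measure Ω) [IsProbabilityMeasure ρ] {QB QS : Ω → ℝ} (hB : Measurable QB)
    (hS : Measurable QS) (hBm : Monotone QB) (hSm : Monotone QS) (hle : ∀ q, QS q ≤ QB q)
    {m n : ℕ} (hnm : n ≤ m) :
    expectedOPT (ρ.map QB) (ρ.map QS) m n ≤
      expectedSTR (ρ.map QB) (ρ.map QS) (m + 64) (n + 64) := by
  classical
  obtain ⟨T, hT⟩ : ∃ T, T = (m + 64) + (n + 64) := ⟨_, rfl⟩
  let E := Fin (m + 64) ⊕ Fin (n + 64) ≃ Fin T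
  have e : E := finSumFinEquiv.trans (finCongr hT.symm)
  let F : (Fin T → Ω) → E → ℝ := fun u π =>
    (firstBest (fun i => QB (u (π (Sum.inl (Fin.castAdd 64 i)))))
        (fun j => QS (u (π (Sum.inr (Fin.castAdd 64 j)))))).gft
      (fun i => QB (u (π (Sum.inl (Fin.castAdd 64 i)))))
      (fun j => QS (u (π (Sum.inr (Fin.castAdd 64 j)))))
  let G : (Fin T → Ω) → E → ℝ := fun u π =>
    (sellerTradeReduction (fun i => QB (u (π (Sum.inl i))))
        (fun j => QS (u (π (Sum.inr j))))).allocation.gft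
      (fun i => QB (u (π (Sum.inl i)))) (fun j => QS (u (π (Sum.inr j))))
  have hinj : ∀ π : E, Function.Injective fun a : Fin m ⊕ Fin n =>
      π (Sum.map (Fin.castAdd 64) (Fin.castAdd 64) a) := fun π =>
    π.injective.comp (Sum.map_injective.2
      ⟨Fin.castAdd_injective _ _, Fin.castAdd_injective _ _⟩)
  have hF := fun π : E => lintegral_firstBest_gft ρ hB hS (hinj π)
  have hG := fun π : E => lintegral_sellerTradeReduction_gft ρ hB hS π.injective
  simp only [Sum.map_inl, Sum.map_inr] at hF
  have hpt : ∀ u, ∑ π, F u π ≤ ∑ π, G u π := by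
    intro u
    -- relabel the positions so that the quantiles are listed in decreasing order
    let τ : Equiv.Perm (Fin T) := Fin.revPerm.trans (Tuple.sort u)
    have hτ : Antitone fun p => u (τ p) := fun p q hpq =>
      Tuple.monotone_sort u (Fin.rev_le_rev.2 hpq)
    have h := sum_firstBest_le_sum_sellerTradeReduction hnm hT
      (β := fun p => QB (u (τ p))) (σ := fun p => QS (u (τ p)))
      (hBm.comp_antitone hτ) (hSm.comp_antitone hτ) (fun p => hle _)
    have hFe : ∑ π, F u π = ∑ π : E, F u (π.trans τ) :=
      (Fintype.sum_equiv (Equiv.equivCongr (Equiv.refl _) τ) _ _ fun π => rfl).symm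
    have hGe : ∑ π, G u π = ∑ π : E, G u (π.trans τ) :=
      (Fintype.sum_equiv (Equiv.equivCongr (Equiv.refl _) τ) _ _ fun π => rfl).symm
    rw [hFe, hGe]
    exact h
  have hsum : ∑ _π : E, expectedOPT (ρ.map QB) (ρ.map QS) m n ≤
      ∑ _π : E, expectedSTR (ρ.map QB) (ρ.map QS) (m + 64) (n + 64) := by
    rw [← Finset.sum_congr rfl fun π _ => (hF π).2, ← Finset.sum_congr rfl fun π _ => (hG π).2,
      ← lintegral_finsetSum' _ fun π _ => (hF π).1, ← lintegral_finsetSum' _ fun π _ => (hG π).1]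
    refine lintegral_mono fun u => ?_
    rw [← ENNReal.ofReal_sum_of_nonneg fun π _ => firstBest_gft_nonneg _ _,
      ← ENNReal.ofReal_sum_of_nonneg fun π _ => sellerTradeReduction_gft_nonneg _ _]
    exact ENNReal.ofReal_le_ofReal (hpt u)
  rw [Finset.sum_const, Finset.sum_const, nsmul_eq_mul, nsmul_eq_mul] at hsum
  refine (ENNReal.mul_le_mul_iff_right ?_ (ENNReal.natCast_ne_top _)).1 hsum
  exact Nat.cast_ne_zero.2 (Finset.card_ne_zero_of_mem (Finset.mem_univ e))

/-! ### Quantile functions -/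

theorem quantile_le_iff (μ : Measure ℝ) [IsProbabilityMeasure μ] {q : ℝ} (hq : q ∈ Set.Ioo 0 1)
    (x : ℝ) : quantile μ q ≤ x ↔ q ≤ μ.real (Set.Iic x) := by
  simp only [quantile, ← ProbabilityTheory.cdf_eq_real]
  set F := ProbabilityTheory.cdf μ
  have hbdd : BddBelow {x : ℝ | q ≤ F x} := by
    obtain ⟨y, hy⟩ := ((ProbabilityTheory.tendsto_cdf_atBot μ).eventually_lt_const hq.1).exists
    exact ⟨y, fun x hx => le_of_not_gt fun hxy =>
      absurd (hx.trans (F.mono hxy.le)) (not_le.2 hy)⟩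
  have hne : {x : ℝ | q ≤ F x}.Nonempty := by
    obtain ⟨y, hy⟩ := ((ProbabilityTheory.tendsto_cdf_atTop μ).eventually_const_lt hq.2).exists
    exact ⟨y, hy.le⟩
  refine ⟨fun h => ?_, fun h => csInf_le hbdd h⟩
  -- right continuity of the distribution function shows that the infimum is attained
  have hmem : q ≤ F (sInf {x : ℝ | q ≤ F x}) := by
    have ht : Filter.Tendsto F (nhdsWithin (sInf {x : ℝ | q ≤ F x}) (Set.Ioi _))
        (nhds (F (sInf {x : ℝ | q ≤ F x}))) :=
      (F.right_continuous _).mono_left (nhdsWithin_mono _ Set.Ioi_subset_Ici_self)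
    refine ge_of_tendsto ht ?_
    filter_upwards [self_mem_nhdsWithin] with y hy
    obtain ⟨z, hz, hzy⟩ := exists_lt_of_csInf_lt hne hy
    exact le_trans hz (F.mono hzy.le)
  exact hmem.trans (F.mono h)

theorem quantile_mono (μ : Measure ℝ) [IsProbabilityMeasure μ] :
    Monotone fun q : Set.Ioo (0 : ℝ) 1 => quantile μ q := fun q q' h =>
  (quantile_le_iff μ q.2 _).2 (le_trans h ((quantile_le_iff μ q'.2 _).1 le_rfl))

/-- The quantile of a uniform random number in `(0, 1)` has law `μ`. -/
theorem map_quantile (μ : Measure ℝ) [IsProbabilityMeasure μ] :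
    (Measure.comap Subtype.val volume : Measure (Set.Ioo (0 : ℝ) 1)).map
      (fun q : Set.Ioo (0 : ℝ) 1 => quantile μ q) = μ := by
  have hm := (quantile_mono μ).measurable
  have hset : ∀ a, ((Measure.comap Subtype.val volume : Measure (Set.Ioo (0 : ℝ) 1)).map
      (fun q : Set.Ioo (0 : ℝ) 1 => quantile μ q)) (Set.Iic a) = μ (Set.Iic a) := by
    intro a
    rw [Measure.map_apply hm measurableSet_Iic, comap_subtype_coe_apply measurableSet_Ioo,
      ← ofReal_measureReal (μ := μ)]
    have h1 := measureReal_le_one (μ := μ) (s := Set.Iic a)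
    refine le_antisymm ?_ ?_
    · refine (measure_mono (t := Set.Ioc 0 (μ.real (Set.Iic a))) ?_).trans (by simp)
      rintro _ ⟨q, hq, rfl⟩
      exact ⟨q.2.1, (quantile_le_iff μ q.2 a).1 hq⟩
    · refine le_trans (by simp) (measure_mono (s := Set.Ioo 0 (μ.real (Set.Iic a))) ?_)
      rintro q ⟨hq0, hq1⟩
      exact ⟨⟨q, hq0, hq1.trans_le h1⟩, (quantile_le_iff μ ⟨hq0, hq1.trans_le h1⟩ a).2 hq1.le, rfl⟩
  refine (Measure.ext_of_Iic _ _ fun a => (hset a).symm).symm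

end DoubleAuction

theorem theorem1 :
    ∃ c : ℕ, 0 < c ∧
      ∀ (m n : ℕ), n ≤ m →
        ∀ (FB FS : Measure ℝ) [IsProbabilityMeasure FB] [IsProbabilityMeasure FS],
          DoubleAuction.FSD FB FS →
            DoubleAuction.expectedOPT FB FS m n ≤
              DoubleAuction.expectedSTR FB FS (m + c) (n + c) := by
  refine ⟨64, by norm_num, fun m n hnm FB FS _ _ hFSD => ?_⟩
  have hprob : IsProbabilityMeasure
      (Measure.comap Subtype.val volume : Measure (Set.Ioo (0 : ℝ) 1)) :=
    ⟨by rw [comap_subtype_coe_apply measurableSet_Ioo, Set.image_univ, Subtype.range_coe]; simp⟩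
  have hB := DoubleAuction.quantile_mono FB
  have hS := DoubleAuction.quantile_mono FS
  have h := DoubleAuction.expectedOPT_le_expectedSTR_of_monotone
    (Measure.comap Subtype.val volume : Measure (Set.Ioo (0 : ℝ) 1)) hB.measurable hS.measurable
    hB hS (fun q => hFSD q q.2) hnm
  rwa [DoubleAuction.map_quantile, DoubleAuction.map_quantile] at h
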